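/- Let $\Omega=(a,b)$ with $a<b$, $\mu>0$, $T>0$, let $p\ge 1$ be an integer and $\mathcal F(s)=-s(1+p\,s^p)$. Write $(\cdot,\cdot)$ and $\|\cdot\|$ for the inner product and norm of $L^2(\Omega)$, and $\|\cdot\|_k$ for the usual norm of $H^k(\Omega)$. Let $(S_h)_{0<h<1}$ be finite dimensional subspaces of $H^1_0(\Omega)$ with the following approximation property: there is a constant $K$, independent of $h$, such that for all $h\in(0,1)$ and all $v\in H_0^1(\Omega)\cap H^4(\Omega)$ $$\inf_{\xi\in S_h}\|v-\xi\|\le K h^4\|v\|_4,\qquad \inf_{\xi\in S_h}\|v-\xi\|_1\le K h^3\|v\|_4 .$$ Let $u:[0,T]\to H^1_0(\Omega)$ be differentiable in $H_0^1(\Omega)$ and solve $$(u_t,\xi)+\mu(\nabla u_t,\nabla\xi)=-(\mathcal F(u),\nabla\xi)\quad\text{for all }\xi\in H_0^1(\Omega),\ t\in[0,T],\qquad u(0)=u_0,$$ and suppose that $u(t)\in H^4(\Omega)$ for all $t\in[0,T]$ with $\sup_{t\in[0,T]}\|u(t)\|_4<\infty$. For each $h\in(0,1)$ let $u_h:[0,T]\to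 S_h$ be differentiable and solve the semi-discrete Galerkin problem $$(u_{h,t},\xi)+\mu(\nabla u_{h,t},\nabla\xi)=-(\mathcal F(u_h),\nabla\xi)\quad\text{for all }\xi\in S_h,\ t\in[0,T],\qquad u_h(0)=u_{0,h}\in S_h,$$ where the discrete initial data are bounded in $H^1(\Omega)$ independently of $h$, $\sup_{0<h<1}\|u_{0,h}\|_1<\infty$, and satisfy $\|u(0)-u_{0,h}\|\le C_0h^4$ for all $h\in(0,1)$, with $C_0$ independent of $h$. Then there is a constant $C>0$, independent of $h$ and $t$, such that $$\|u(t)-u_h(t)\|\le C h^4\qquad\text{for all } h\in(0,1),\ t\in[0,T].$$ -/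

import Mathlib

open MeasureTheory Set
open scoped ContDiff

namespace GRLW

/-- `L²(Ω)` for the interval `Ω = (a, b)`, with its usual norm and inner product. -/
abbrev L2 (a b : ℝ) : Type := Lp ℝ 2 (volume.restrict (Ioo a b))

/-- `g` is the weak derivative of `f` on `(a, b)`: integration by parts holds against every
smooth function with compact support in `(a, b)`. -/
def IsWeakDeriv {a b : ℝ} (f g : L2 a b) : Prop :=
  ∀ φ : ℝ → ℝ, ContDiff ℝ ∞ φ → HasCompactSupport φ → tsupport φ ⊆ Ioo a b →
    ∫ x in Ioo a b, f x * deriv φ x = - ∫ x in Ioo a b, g x * φ x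

theorem integrable_mul_test {a b : ℝ} (f : L2 a b) {ψ : ℝ → ℝ} (hψ : Continuous ψ)
    (hc : HasCompactSupport ψ) :
    Integrable (fun x => f x * ψ x) (volume.restrict (Ioo a b)) :=
  MemLp.integrable_mul (p := 2) (q := 2) (Lp.memLp f) (hψ.memLp_of_hasCompactSupport hc)

theorem IsWeakDeriv.zero {a b : ℝ} : IsWeakDeriv (0 : L2 a b) 0 := by
  intro φ _ _ _
  have h : ∀ ψ : ℝ → ℝ, ∫ x in Ioo a b, (0 : L2 a b) x * ψ x = 0 := by
    intro ψ
    refine integral_eq_zero_of_ae ?_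
    filter_upwards [Lp.coeFn_zero ℝ 2 (volume.restrict (Ioo a b))] with x hx
    exact mul_eq_zero_of_left hx _
  rw [h, h, neg_zero]

theorem IsWeakDeriv.add {a b : ℝ} {f g f' g' : L2 a b} (h : IsWeakDeriv f f')
    (k : IsWeakDeriv g g') : IsWeakDeriv (f + g) (f' + g') := by
  intro φ hφ hc hs
  have e : ∀ (p q : L2 a b) (ψ : ℝ → ℝ), Continuous ψ → HasCompactSupport ψ →
      ∫ x in Ioo a b, (p + q) x * ψ x
        = (∫ x in Ioo a b, p x * ψ x) + ∫ x in Ioo a b, q x * ψ x := by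
    intro p q ψ hψ hψc
    rw [← integral_add (integrable_mul_test p hψ hψc) (integrable_mul_test q hψ hψc)]
    refine integral_congr_ae ?_
    filter_upwards [Lp.coeFn_add p q] with x hx
    simp only [hx, Pi.add_apply, add_mul]
  rw [e f g _ (hφ.continuous_deriv (by simp)) hc.deriv, e f' g' _ hφ.continuous hc,
    h φ hφ hc hs, k φ hφ hc hs]
  ring

theorem IsWeakDeriv.smul {a b : ℝ} {f f' : L2 a b} (c : ℝ) (h : IsWeakDeriv f f') :
    IsWeakDeriv (c • f) (c • f') := by
  intro φ hφ hc hs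
  have e : ∀ (p : L2 a b) (ψ : ℝ → ℝ),
      ∫ x in Ioo a b, (c • p) x * ψ x = c * ∫ x in Ioo a b, p x * ψ x := by
    intro p ψ
    rw [← integral_const_mul]
    refine integral_congr_ae ?_
    filter_upwards [Lp.coeFn_smul c p] with x hx
    simp only [hx, Pi.smul_apply, smul_eq_mul, mul_assoc]
  rw [e, e, h φ hφ hc hs]
  ring

/-- The Sobolev space `H^k(a, b)`. An element is a square integrable function (component `0`)
together with its weak derivatives of orders `1, …, k`; the inherited norm is the usual one,
`‖v‖_k = (∑_{i ≤ k} ‖D^i v‖²)^{1/2}`. -/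
def Sobolev (a b : ℝ) (k : ℕ) : Submodule ℝ (PiLp 2 fun _ : Fin (k + 1) => L2 a b) where
  carrier := {v | ∀ i : Fin k, IsWeakDeriv (v i.castSucc) (v i.succ)}
  zero_mem' := fun _ => IsWeakDeriv.zero
  add_mem' := fun hv hw i => (hv i).add (hw i)
  smul_mem' := fun c _ hv i => (hv i).smul c

/-- The `i`-th weak derivative `D^i v` of `v ∈ H^k(a, b)`, as an element of `L²(a, b)`;
`D^0 v` is the function itself. -/
def Sobolev.D {a b : ℝ} {k : ℕ} (i : Fin (k + 1)) (v : Sobolev a b k) : L2 a b :=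
  (v : PiLp 2 fun _ : Fin (k + 1) => L2 a b) i

/-- `H¹₀(a, b)`: the `v ∈ H¹(a, b)` with `v = 0` on the boundary `{a, b}`, boundary values being
those of the representative that is continuous on `[a, b]`. The norm is that of `H¹(a, b)`. -/
def H10 (a b : ℝ) : Submodule ℝ (Sobolev a b 1) where
  carrier := {v | ∃ c : ℝ → ℝ, ContinuousOn c (Icc a b) ∧
    c =ᵐ[volume.restrict (Ioo a b)] Sobolev.D 0 v ∧ c a = 0 ∧ c b = 0}
  zero_mem' :=
    ⟨0, continuousOn_const, (Lp.coeFn_zero ℝ 2 (volume.restrict (Ioo a b))).symm, rfl, rfl⟩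
  add_mem' := by
    rintro v w ⟨c, hc, hcv, hca, hcb⟩ ⟨d, hd, hdw, hda, hdb⟩
    exact ⟨c + d, hc.add hd,
      (hcv.add hdw).trans (Lp.coeFn_add (Sobolev.D 0 v) (Sobolev.D 0 w)).symm,
      by simp [hca, hda], by simp [hcb, hdb]⟩
  smul_mem' := by
    rintro r v ⟨c, hc, hcv, hca, hcb⟩
    exact ⟨r • c, hc.const_smul r,
      (hcv.const_smul r).trans (Lp.coeFn_smul r (Sobolev.D 0 v)).symm,
      by simp [hca], by simp [hcb]⟩

/-- The function `v ∈ L²(a, b)` underlying an element of `H¹₀(a, b)`. -/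
def fn {a b : ℝ} (v : H10 a b) : L2 a b := Sobolev.D 0 (v : Sobolev a b 1)

/-- The gradient `∇v ∈ L²(a, b)` of an element of `H¹₀(a, b)`. -/
def grad {a b : ℝ} (v : H10 a b) : L2 a b := Sobolev.D 1 (v : Sobolev a b 1)

/-- `w` is `v ∈ H¹₀(a, b)` seen as an element of `H⁴(a, b)`: they are the same function, so
`∃ w, IsH4 v w` says `v ∈ H¹₀ ∩ H⁴`, and then `‖w‖` is `‖v‖_4`. -/
def IsH4 {a b : ℝ} (v : H10 a b) (w : Sobolev a b 4) : Prop := Sobolev.D 0 w = fn v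

/-- The nonlinearity `F(s) = -s (1 + p s^p)`. -/
def flux (p : ℕ) (s : ℝ) : ℝ := -(s * (1 + p * s ^ p))

/-- `u : [0, T] → V` is a solution of the variational problem posed on the subspace `V` of
`H¹₀(a, b)`: `u(0) = u₀`, and at every `t ∈ [0, T]` the derivative `w = u_t` exists in
`H¹₀(a, b)` (one-sided at the end points) and
`(u_t, ξ) + μ (∇u_t, ∇ξ) = -(F(u), ∇ξ)` for all `ξ ∈ V`. The continuous problem is `V = H¹₀`,
the semi-discrete Galerkin problem is `V = S_h`. -/
structure IsSolution {a b : ℝ} (μ : ℝ) (p : ℕ) (T : ℝ) (V : Submodule ℝ (H10 a b))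
    (u₀ : H10 a b) (u : ℝ → H10 a b) : Prop where
  mem : ∀ t ∈ Icc 0 T, u t ∈ V
  initial : u 0 = u₀
  equation : ∀ t ∈ Icc 0 T, ∃ w : H10 a b, HasDerivWithinAt u w (Icc 0 T) t ∧
    ∀ ξ ∈ V, inner ℝ (fn w) (fn ξ) + μ * inner ℝ (grad w) (grad ξ)
      = - ∫ x in Ioo a b, flux p (fn (u t) x) * grad ξ x

/-- The approximation property, of fourth order, of a family `(S_h)_{0 < h < 1}` of subspaces of
`H¹₀(a, b)`: there is a constant `K`, independent of `h`, such that for all `v ∈ H¹₀ ∩ H⁴`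
`inf_{ξ ∈ S_h} ‖v - ξ‖ ≤ K h⁴ ‖v‖_4` and `inf_{ξ ∈ S_h} ‖v - ξ‖_1 ≤ K h³ ‖v‖_4`. -/
def ApproximationProperty {a b : ℝ} (S : ℝ → Submodule ℝ (H10 a b)) : Prop :=
  ∃ K : ℝ, ∀ h ∈ Ioo (0 : ℝ) 1, ∀ (v : H10 a b) (w : Sobolev a b 4), IsH4 v w →
    (⨅ ξ : S h, ‖fn (v - (ξ : H10 a b))‖) ≤ K * h ^ 4 * ‖w‖ ∧
    (⨅ ξ : S h, ‖v - (ξ : H10 a b)‖) ≤ K * h ^ 3 * ‖w‖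

end GRLW

namespace GRLW

/-! The proof compares `u_h` with the Ritz projection of `u`, taken in the energy inner product `(v,
w) + μ (∇v, ∇w)`.

Stability: `(F(v), ∇v) = 0` for `v` in `H¹₀`, because the integrand is an exact derivative. Hence
both problems conserve the energy. In one dimension the energy controls the sup norm, so on the
range of all solutions `F` is Lipschitz with a constant independent of `h` and `t`
(`IsSolution.ae_abs_le`, `flux_sub_le`).

Evolution: let `θ` be the Ritz projection of `u` minus `u_h`. Testing the difference of the
equations with `θ_t` gives an energy norm of `θ_t` at most `c ‖u - u_h‖`. The term `μ ∇u_t` absorbs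
the gradient on the test function, so only the `L²` error appears. Gronwall then reduces the claim
to an `L²` bound for the Ritz error (`norm_fn_sub_le_of_ritz`).

Ritz error: Céa's lemma gives order `h³` in the energy norm, and duality should gain a factor `h`
(`exists_ritz_error_bound`). The dual solution `φ` is only in `H²`, whereas approximation is assumed
for `H⁴`. So `φ` is regularised at scale `h`: a remainder of size `h` in `H¹` is split off, and what
is left has `H⁴` norm of order `h⁻²`, which still gives `h³ · h⁻² = h` (`exists_dual_solution`). -/

/-! ### Primitives of square integrable functions. -/

theorem intervalIntegrable_coe {a b : ℝ} (hab : a ≤ b) (g : L2 a b) :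
    IntervalIntegrable g volume a b := by
  rw [intervalIntegrable_iff_integrableOn_Ioo_of_le hab]
  exact (Lp.memLp g).integrable (by norm_num)

theorem integral_mul_eq_inner {a b : ℝ} (f g : L2 a b) :
    ∫ x in Ioo a b, f x * g x = inner ℝ f g := by
  rw [L2.inner_def]
  refine integral_congr_ae (.of_forall fun x => ?_)
  simp [mul_comm]

/-- The primitive of `g` vanishing at `a`. -/
noncomputable def prim {a b : ℝ} (g : L2 a b) (x : ℝ) : ℝ := ∫ t in a..x, g t

theorem prim_left {a b : ℝ} (g : L2 a b) : prim g a = 0 := by simp [prim]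

theorem absolutelyContinuousOnInterval_prim {a b : ℝ} (hab : a ≤ b) (g : L2 a b) :
    AbsolutelyContinuousOnInterval (prim g) a b :=
  (intervalIntegrable_coe hab g).absolutelyContinuousOnInterval_intervalIntegral (by simp)

theorem continuousOn_prim {a b : ℝ} (hab : a ≤ b) (g : L2 a b) :
    ContinuousOn (prim g) (Icc a b) := by
  simpa [uIcc_of_le hab] using (absolutelyContinuousOnInterval_prim hab g).continuousOn

theorem ae_hasDerivAt_prim {a b : ℝ} (hab : a ≤ b) (g : L2 a b) :
    ∀ᵐ x, x ∈ uIcc a b → HasDerivAt (prim g) (g x) x := by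
  filter_upwards [(intervalIntegrable_coe hab g).ae_hasDerivAt_integral] with x hx h
  exact hx h a (by simp)

theorem prim_congr {a b : ℝ} {g : L2 a b} {ψ : ℝ → ℝ}
    (h : g =ᵐ[volume.restrict (Ioo a b)] ψ) {x : ℝ} (hx : x ∈ Icc a b) :
    prim g x = ∫ t in a..x, ψ t := by
  unfold prim
  rw [intervalIntegral.integral_of_le hx.1, intervalIntegral.integral_of_le hx.1,
    integral_Ioc_eq_integral_Ioo, integral_Ioc_eq_integral_Ioo]
  exact integral_congr_ae (ae_restrict_of_ae_restrict_of_subset (Ioo_subset_Ioo_right hx.2) h)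

theorem intervalIntegrable_coe_of_mem {a b : ℝ} (g : L2 a b) {x : ℝ} (hx : x ∈ Icc a b) :
    IntervalIntegrable g volume a x :=
  (intervalIntegrable_coe (hx.1.trans hx.2) g).mono_set (by
    rw [uIcc_of_le hx.1, uIcc_of_le (hx.1.trans hx.2)]; exact Icc_subset_Icc_right hx.2)

theorem prim_add {a b : ℝ} (f g : L2 a b) {x : ℝ} (hx : x ∈ Icc a b) :
    prim (f + g) x = prim f x + prim g x := by
  rw [prim_congr (Lp.coeFn_add f g) hx]
  exact intervalIntegral.integral_add (intervalIntegrable_coe_of_mem f hx)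
    (intervalIntegrable_coe_of_mem g hx)

theorem prim_smul {a b : ℝ} (c : ℝ) (g : L2 a b) {x : ℝ} (hx : x ∈ Icc a b) :
    prim (c • g) x = c * prim g x := by
  rw [prim_congr (Lp.coeFn_smul c g) hx]
  exact intervalIntegral.integral_const_mul _ _

/-- Cauchy–Schwarz against the constant `1`. This is the source of the embedding of `H¹₀` in `L^∞`.
-/
theorem abs_prim_le {a b : ℝ} (g : L2 a b) {x : ℝ} (hx : x ∈ Icc a b) :
    |prim g x| ≤ √(b - a) * ‖g‖ := by
  have hab := hx.1.trans hx.2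
  have h1 : |prim g x| ≤ ∫ t in Ioo a b, ‖g t‖ := by
    rw [← Real.norm_eq_abs, prim, ← integral_Ioc_eq_integral_Ioo]
    refine (intervalIntegral.norm_integral_le_integral_norm hx.1).trans ?_
    rw [intervalIntegral.integral_of_le hx.1]
    refine setIntegral_mono_set ?_ (.of_forall fun _ => norm_nonneg _)
      (Ioc_subset_Ioc_right hx.2).eventuallyLE
    exact ((intervalIntegrable_iff_integrableOn_Ioc_of_le hab).1
      (intervalIntegrable_coe hab g)).norm
  refine h1.trans ?_
  have hm : MemLp (fun _ : ℝ => (1 : ℝ)) 2 (volume.restrict (Ioo a b)) := memLp_const 1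
  have h2 : ∫ t in Ioo a b, ‖g t‖ = inner ℝ (hm.toLp) (Lp.memLp g).norm.toLp := by
    rw [← integral_mul_eq_inner]
    refine integral_congr_ae ?_
    filter_upwards [hm.coeFn_toLp, (Lp.memLp g).norm.coeFn_toLp] with t h1 h2
    rw [h1, h2, one_mul]
  rw [h2]
  refine (real_inner_le_norm _ _).trans (le_of_eq ?_)
  congr 1
  · rw [Lp.norm_toLp, eLpNorm_const' _ (by norm_num) (by norm_num)]
    simp [Real.sqrt_eq_rpow, ENNReal.toReal_ofReal, hab, ← ENNReal.toReal_rpow]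
  · rw [Lp.norm_toLp, eLpNorm_norm, Lp.norm_def]

/-- Integration by parts for absolutely continuous functions. The boundary term at `b` is assumed to
vanish as a product, so that either factor may be the one that is zero: both cases occur below. -/
theorem integral_prim_mul_deriv {a b : ℝ} (hab : a ≤ b) (g : L2 a b) {φ : ℝ → ℝ}
    (hφ : ContDiff ℝ ∞ φ) (hb : prim g b * φ b = 0) :
    ∫ x in Ioo a b, prim g x * deriv φ x = - ∫ x in Ioo a b, g x * φ x := by
  have hac : AbsolutelyContinuousOnInterval φ a b :=
    ContDiffOn.absolutelyContinuousOnInterval ((hφ.of_le (by simp)).contDiffOn)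
  have h := (absolutelyContinuousOnInterval_prim hab g).integral_mul_deriv_eq_deriv_mul hac
  rw [hb, prim_left, zero_mul, sub_zero, zero_sub, intervalIntegral.integral_of_le hab,
    integral_Ioc_eq_integral_Ioo] at h
  rw [h, ← integral_Ioc_eq_integral_Ioo, ← intervalIntegral.integral_of_le hab]
  congr 1
  refine intervalIntegral.integral_congr_ae ?_
  filter_upwards [ae_hasDerivAt_prim hab g] with x hx h
  rw [(hx (uIoc_subset_uIcc h)).deriv]

/-- Powers of a primitive are absolutely continuous, so the chain rule holds almost everywhere and
the fundamental theorem of calculus applies. -/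
theorem integral_prim_pow_mul {a b : ℝ} (hab : a ≤ b) (g : L2 a b) (n : ℕ) :
    ∫ x in Ioo a b, prim g x ^ n * g x = prim g b ^ (n + 1) / (n + 1) := by
  have hy := absolutelyContinuousOnInterval_prim hab g
  have hp : ∀ k : ℕ, AbsolutelyContinuousOnInterval (fun x => prim g x ^ (k + 1)) a b := by
    intro k
    induction k with
    | zero => simpa using hy
    | succ k ih => simpa only [pow_succ _ (k + 1)] using ih.fun_mul hy
  have h := (hp n).integral_deriv_eq_sub
  have e : ∫ x in a..b, deriv (fun x => prim g x ^ (n + 1)) x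
      = ∫ x in a..b, (n + 1 : ℝ) * (prim g x ^ n * g x) := by
    refine intervalIntegral.integral_congr_ae ?_
    filter_upwards [ae_hasDerivAt_prim hab g] with x hx h
    rw [((hx (uIoc_subset_uIcc h)).fun_pow (n + 1)).deriv]
    push_cast [Nat.add_sub_cancel]
    ring
  rw [e, intervalIntegral.integral_const_mul, prim_left, zero_pow (by simp), sub_zero,
    intervalIntegral.integral_of_le hab, integral_Ioc_eq_integral_Ioo] at h
  rw [← h]
  field_simp

/-! ### Test functions and the du Bois-Reymond lemma. -/

theorem exists_test_integral_eq_one {a b : ℝ} (hab : a < b) :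
    ∃ η : ℝ → ℝ, ContDiff ℝ ∞ η ∧ HasCompactSupport η ∧ tsupport η ⊆ Ioo a b ∧
      ∫ x, η x = 1 := by
  let f : ContDiffBump ((a + b) / 2) :=
    ⟨(b - a) / 8, (b - a) / 4, by linarith, by linarith⟩
  refine ⟨f.normed volume, f.contDiff_normed, f.hasCompactSupport_normed, ?_, f.integral_normed⟩
  rw [f.tsupport_normed_eq, Real.closedBall_eq_Icc]
  intro x hx
  have h1 : (a + b) / 2 - (b - a) / 4 ≤ x := hx.1
  have h2 : x ≤ (a + b) / 2 + (b - a) / 4 := hx.2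
  constructor <;> linarith

/-- The primitive from `a` is zero to the left of the support of `ψ`; to the right it equals the
total integral, which is zero by `h0`. -/
theorem exists_test_deriv_eq {a b : ℝ} {ψ : ℝ → ℝ} (hψ : ContDiff ℝ ∞ ψ)
    (hc : HasCompactSupport ψ) (hs : tsupport ψ ⊆ Ioo a b) (h0 : ∫ x, ψ x = 0) :
    ∃ φ : ℝ → ℝ, ContDiff ℝ ∞ φ ∧ HasCompactSupport φ ∧ tsupport φ ⊆ Ioo a b ∧
      deriv φ = ψ := by
  let φ : ℝ → ℝ := fun x => ∫ t in a..x, ψ t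
  have hd : ∀ x, HasDerivAt φ (ψ x) x := fun x =>
    intervalIntegral.integral_hasDerivAt_right (hψ.continuous.intervalIntegrable _ _)
      hψ.continuous.stronglyMeasurable.stronglyMeasurableAtFilter hψ.continuous.continuousAt
  have hd' : deriv φ = ψ := funext fun x => (hd x).deriv
  have hsub : tsupport φ ⊆ Ioo a b ∧ HasCompactSupport φ := by
    rcases (tsupport ψ).eq_empty_or_nonempty with he | hne
    · have hψ0 : ψ = 0 := tsupport_eq_empty_iff.1 he
      have : φ = 0 := by
        ext x
        simp [φ, hψ0]
      rw [this]
      exact ⟨by simp, HasCompactSupport.zero⟩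
    obtain ⟨c, hcm, hcl⟩ := hc.isCompact.exists_isLeast hne
    obtain ⟨d, hdm, hdg⟩ := hc.isCompact.exists_isGreatest hne
    have hsupp : Function.support φ ⊆ Icc c d := by
      intro x hx
      by_contra hcon
      refine hx ?_
      rw [mem_Icc, not_and_or, not_le, not_le] at hcon
      have hz : ∀ t, t ∉ Icc c d → ψ t = 0 := fun t ht =>
        image_eq_zero_of_notMem_tsupport fun h => ht ⟨hcl h, hdg h⟩
      rcases hcon with hlt | hlt
      · refine (intervalIntegral.integral_congr (g := fun _ => 0) fun t ht => hz t ?_).trans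
          (by simp)
        have := ht.2.trans_lt (max_lt (hs hcm).1 hlt)
        exact fun h => absurd h.1 (not_le.2 this)
      · have e : ∫ t in a..x, ψ t = ∫ t, ψ t := by
          refine intervalIntegral.integral_eq_integral_of_support_subset fun t ht => ?_
          have := subset_tsupport ψ ht
          exact ⟨(hs this).1, (hdg this).trans hlt.le⟩
        exact e.trans h0
    have hts : tsupport φ ⊆ Icc c d := closure_minimal hsupp isClosed_Icc
    exact ⟨hts.trans fun t ht => ⟨(hs hcm).1.trans_le ht.1, ht.2.trans_lt (hs hdm).2⟩,
      HasCompactSupport.intro isCompact_Icc fun t ht =>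
        image_eq_zero_of_notMem_tsupport fun h => ht (hts h)⟩
  refine ⟨φ, ?_, hsub.2, hsub.1, hd'⟩
  exact contDiff_infty_iff_deriv.2 ⟨fun x => (hd x).differentiableAt, hd' ▸ hψ⟩

theorem setIntegral_eq_integral_of_tsupport {a b : ℝ} {f ψ : ℝ → ℝ}
    (hs : tsupport ψ ⊆ Ioo a b) : ∫ x in Ioo a b, f x * ψ x = ∫ x, f x * ψ x :=
  setIntegral_eq_integral_of_forall_compl_eq_zero fun x hx => by
    rw [image_eq_zero_of_notMem_tsupport fun h => hx (hs h), mul_zero]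

/-- The du Bois-Reymond lemma. -/
theorem ae_eq_const_of_integral_mul_deriv_eq_zero {a b : ℝ} (hab : a < b) {d : ℝ → ℝ}
    (hd : IntegrableOn d (Ioo a b))
    (h : ∀ φ : ℝ → ℝ, ContDiff ℝ ∞ φ → HasCompactSupport φ → tsupport φ ⊆ Ioo a b →
      ∫ x in Ioo a b, d x * deriv φ x = 0) :
    ∃ k : ℝ, ∀ᵐ x ∂volume.restrict (Ioo a b), d x = k := by
  obtain ⟨η, hη, hηc, hηs, hη1⟩ := exists_test_integral_eq_one hab
  refine ⟨∫ x in Ioo a b, d x * η x, ?_⟩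
  set k := ∫ x in Ioo a b, d x * η x
  have hint : ∀ ψ : ℝ → ℝ, Continuous ψ → HasCompactSupport ψ →
      IntegrableOn (fun x => d x * ψ x) (Ioo a b) := by
    intro ψ hψ hc
    obtain ⟨C, hC⟩ := hψ.bounded_above_of_compact_support hc
    exact hd.mul_bdd hψ.aestronglyMeasurable (.of_forall hC)
  have key := isOpen_Ioo.ae_eq_zero_of_integral_contDiff_smul_eq_zero (μ := volume)
    (U := Ioo a b) (f := fun x => d x - k)
    ((hd.sub (integrableOn_const (by simp))).locallyIntegrableOn) ?_
  · rw [ae_restrict_iff' measurableSet_Ioo]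
    filter_upwards [key] with x hx hm
    exact sub_eq_zero.1 (hx hm)
  intro ψ hψ hψc hψs
  set c := ∫ x, ψ x
  have hψi : Integrable ψ := hψ.continuous.integrable_of_hasCompactSupport hψc
  have hηi : Integrable η := hη.continuous.integrable_of_hasCompactSupport hηc
  -- Subtracting `c η` makes `ψ` of mean zero, hence the derivative of a test function.
  obtain ⟨φ, hφ, hφc, hφs, hφd⟩ := exists_test_deriv_eq (a := a) (b := b)
    (ψ := fun x => ψ x - c * η x) (hψ.sub (contDiff_const.mul hη))
    (hψc.sub (hηc.mul_left)) ((tsupport_sub _ _).trans (union_subset hψs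
      ((tsupport_mul_subset_right).trans hηs)))
    (by rw [integral_sub hψi (hηi.const_mul c), integral_const_mul, hη1, mul_one, sub_self])
  have h1 := h φ hφ hφc hφs
  rw [hφd] at h1
  have h2 : ∫ x in Ioo a b, d x * (ψ x - c * η x)
      = (∫ x in Ioo a b, d x * ψ x) - c * k := by
    rw [← integral_const_mul, ← integral_sub (hint ψ hψ.continuous hψc)
      ((hint η hη.continuous hηc).const_mul c)]
    congr 1 with x
    ring
  rw [h2] at h1
  have h3 : ∫ x in Ioo a b, k * ψ x = k * c := by
    rw [setIntegral_eq_integral_of_tsupport (f := fun _ => k) hψs, integral_const_mul]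
  have h4 : ∫ x, ψ x • (d x - k) = ∫ x in Ioo a b, (d x - k) * ψ x := by
    rw [setIntegral_eq_integral_of_tsupport hψs]
    simp [mul_comm]
  rw [h4]
  have h5 : ∫ x in Ioo a b, (d x - k) * ψ x
      = (∫ x in Ioo a b, d x * ψ x) - ∫ x in Ioo a b, k * ψ x := by
    rw [← integral_sub (hint ψ hψ.continuous hψc) (hψi.const_mul k).integrableOn]
    congr 1 with x
    ring
  rw [h5, h3]
  linarith

/-! ### Elements of `H¹₀` as primitives of their gradients. -/

/-- The function and the primitive of its gradient have the same weak derivative, so they differ by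
a constant. The boundary value at `a` makes the constant zero; the one at `b` then gives the second
claim. With the converse `H10.exists_of_prim` this characterises `H¹₀`. -/
theorem H10.fn_ae_eq_prim_and {a b : ℝ} (hab : a < b) (v : H10 a b) :
    fn v =ᵐ[volume.restrict (Ioo a b)] prim (grad v) ∧ prim (grad v) b = 0 := by
  obtain ⟨c, hc, hcv, hca, hcb⟩ := v.2
  have hw : IsWeakDeriv (fn v) (grad v) := (v : Sobolev a b 1).2 0
  have hp := continuousOn_prim hab.le (grad v)
  have hpi : IntegrableOn (prim (grad v)) (Ioo a b) :=
    (hp.integrableOn_compact isCompact_Icc).mono_set Ioo_subset_Icc_self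
  have hvi : IntegrableOn (fn v) (Ioo a b) := (Lp.memLp (fn v)).integrable (by norm_num)
  obtain ⟨k, hk⟩ := ae_eq_const_of_integral_mul_deriv_eq_zero hab (hvi.sub hpi) (by
    intro φ hφ hφc hφs
    have hφ0 : φ b = 0 := image_eq_zero_of_notMem_tsupport fun h => lt_irrefl _ (hφs h).2
    have h1 := hw φ hφ hφc hφs
    have h2 := integral_prim_mul_deriv hab.le (grad v) hφ (by rw [hφ0, mul_zero])
    have hdc : Continuous (deriv φ) := hφ.continuous_deriv (by simp)
    obtain ⟨C, hC⟩ := hdc.bounded_above_of_compact_support hφc.deriv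
    have h3 := integral_sub (hvi.mul_bdd hdc.aestronglyMeasurable (.of_forall hC))
      (hpi.mul_bdd hdc.aestronglyMeasurable (.of_forall hC))
    rw [h1, h2, sub_self] at h3
    rw [← h3]
    congr 1 with x
    simp only [Pi.sub_apply]
    ring)
  have hck : EqOn c (fun x => prim (grad v) x + k) (Icc a b) := by
    refine Measure.eqOn_Icc_of_ae_eq volume hab.ne ?_ hc (hp.add continuousOn_const)
    rw [← restrict_Ioo_eq_restrict_Icc]
    filter_upwards [hcv, hk] with x h1 h2
    rw [h1, ← h2]
    simp [fn]
  have hk0 : k = 0 := by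
    have := hck (left_mem_Icc.2 hab.le)
    simpa [hca, prim_left] using this.symm
  subst hk0
  constructor
  · filter_upwards [hk] with x hx
    exact sub_eq_zero.1 hx
  · have := hck (right_mem_Icc.2 hab.le)
    simpa [hcb] using this.symm

theorem memLp_prim {a b : ℝ} (hab : a ≤ b) (g : L2 a b) :
    MemLp (prim g) 2 (volume.restrict (Ioo a b)) := by
  refine MemLp.of_bound (((continuousOn_prim hab g).mono
    Ioo_subset_Icc_self).aestronglyMeasurable measurableSet_Ioo) (√(b - a) * ‖g‖) ?_
  filter_upwards [ae_restrict_mem measurableSet_Ioo] with x hx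
  exact abs_prim_le g (Ioo_subset_Icc_self hx)

theorem H10.exists_of_prim {a b : ℝ} (hab : a ≤ b) {f g : L2 a b}
    (hf : f =ᵐ[volume.restrict (Ioo a b)] prim g) (hg : prim g b = 0) :
    ∃ v : H10 a b, fn v = f ∧ grad v = g := by
  refine ⟨⟨⟨WithLp.toLp 2 ![f, g], ?_⟩, prim g, continuousOn_prim hab g, hf.symm,
    prim_left g, hg⟩, rfl, rfl⟩
  intro i φ hφ hφc hφs
  fin_cases i
  change ∫ x in Ioo a b, f x * deriv φ x = - ∫ x in Ioo a b, g x * φ x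
  rw [← integral_prim_mul_deriv hab g hφ (by rw [hg, zero_mul])]
  refine integral_congr_ae ?_
  filter_upwards [hf] with x hx
  rw [hx]

theorem H10.exists_of_test {a b : ℝ} (hab : a ≤ b) {φ : ℝ → ℝ} (hφ : ContDiff ℝ ∞ φ)
    (hφc : HasCompactSupport φ) (hφs : tsupport φ ⊆ Ioo a b) :
    ∃ v : H10 a b, fn v =ᵐ[volume.restrict (Ioo a b)] φ ∧
      grad v =ᵐ[volume.restrict (Ioo a b)] deriv φ := by
  have hd : Continuous (deriv φ) := hφ.continuous_deriv (by simp)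
  have hm : MemLp φ 2 (volume.restrict (Ioo a b)) :=
    hφ.continuous.memLp_of_hasCompactSupport hφc
  have hm' : MemLp (deriv φ) 2 (volume.restrict (Ioo a b)) :=
    hd.memLp_of_hasCompactSupport hφc.deriv
  have h0 : ∀ x, x ∉ Ioo a b → φ x = 0 := fun x hx =>
    image_eq_zero_of_notMem_tsupport fun h => hx (hφs h)
  have hp : ∀ x ∈ Icc a b, prim hm'.toLp x = φ x := by
    intro x hx
    rw [prim_congr hm'.coeFn_toLp hx, intervalIntegral.integral_deriv_eq_sub
      (fun y _ => (hφ.differentiable (by simp)) y) (hd.intervalIntegrable _ _),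
      h0 a (by simp), sub_zero]
  obtain ⟨v, h1, h2⟩ := H10.exists_of_prim hab (f := hm.toLp) (g := hm'.toLp) (by
    filter_upwards [hm.coeFn_toLp, ae_restrict_mem measurableSet_Ioo] with x hx hI
    rw [hx, hp x (Ioo_subset_Icc_self hI)]) (by rw [hp b (right_mem_Icc.2 hab), h0 b (by simp)])
  exact ⟨v, h1 ▸ hm.coeFn_toLp, h2 ▸ hm'.coeFn_toLp⟩

theorem H10.ae_abs_fn_le {a b : ℝ} (hab : a < b) (v : H10 a b) :
    ∀ᵐ x ∂volume.restrict (Ioo a b), |fn v x| ≤ √(b - a) * ‖grad v‖ := by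
  filter_upwards [(H10.fn_ae_eq_prim_and hab v).1, ae_restrict_mem measurableSet_Ioo]
    with x hx hI
  rw [hx]
  exact abs_prim_le _ (Ioo_subset_Icc_self hI)

theorem H10.integral_fn_pow_mul_grad {a b : ℝ} (hab : a < b) (v : H10 a b) (n : ℕ) :
    ∫ x in Ioo a b, fn v x ^ n * grad v x = 0 := by
  obtain ⟨h1, h2⟩ := H10.fn_ae_eq_prim_and hab v
  have : ∫ x in Ioo a b, fn v x ^ n * grad v x = ∫ x in Ioo a b, prim (grad v) x ^ n * grad v x := by
    refine integral_congr_ae ?_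
    filter_upwards [h1] with x hx
    rw [hx]
  rw [this, integral_prim_pow_mul hab.le, h2]
  simp

/-! ### The energy inner product and weak solutions of the elliptic problem. -/

theorem exists_volterra {a b : ℝ} (hab : a < b) :
    ∃ J : L2 a b →L[ℝ] L2 a b, ∀ g, J g =ᵐ[volume.restrict (Ioo a b)] prim g := by
  refine ⟨LinearMap.mkContinuousOfExistsBound
    { toFun := fun g => (memLp_prim hab.le g).toLp
      map_add' := fun f g => ?_
      map_smul' := fun c g => ?_ } ⟨measureUnivNNReal (volume.restrict (Ioo a b)) ^ (ENNReal.toReal 2)⁻¹ * √(b - a), fun g => ?_⟩,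
    fun g => (memLp_prim hab.le g).coeFn_toLp⟩
  · rw [← MemLp.toLp_add]
    refine MemLp.toLp_congr _ _ ?_
    filter_upwards [ae_restrict_mem measurableSet_Ioo] with x hI
    exact prim_add f g (Ioo_subset_Icc_self hI)
  · rw [RingHom.id_apply, ← MemLp.toLp_const_smul]
    refine MemLp.toLp_congr _ _ ?_
    filter_upwards [ae_restrict_mem measurableSet_Ioo] with x hI
    exact prim_smul c g (Ioo_subset_Icc_self hI)
  · refine (Lp.norm_le_of_ae_bound (C := √(b - a) * ‖g‖) (by positivity) ?_).trans
      (le_of_eq (mul_assoc _ _ _).symm)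
    filter_upwards [(memLp_prim hab.le g).coeFn_toLp, ae_restrict_mem measurableSet_Ioo]
      with x hx hI
    refine (le_of_eq ?_).trans (abs_prim_le g (Ioo_subset_Icc_self hI))
    rw [← Real.norm_eq_abs, ← hx]
    rfl

theorem continuous_prim_right {a b : ℝ} (hab : a < b) :
    Continuous fun g : L2 a b => prim g b := by
  have hb := right_mem_Icc.2 hab.le
  let l : L2 a b →ₗ[ℝ] ℝ :=
    { toFun := fun g => prim g b
      map_add' := fun f g => prim_add f g hb
      map_smul' := fun c g => prim_smul c g hb }
  exact (l.mkContinuous _ fun g => abs_prim_le g hb).continuous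

/-- `fn` as a continuous linear map. -/
noncomputable def fnL (a b : ℝ) : H10 a b →L[ℝ] L2 a b :=
  (PiLp.proj 2 (fun _ : Fin 2 => L2 a b) 0).comp
    ((Sobolev a b 1).subtypeL.comp (H10 a b).subtypeL)

/-- `grad` as a continuous linear map. -/
noncomputable def gradL (a b : ℝ) : H10 a b →L[ℝ] L2 a b :=
  (PiLp.proj 2 (fun _ : Fin 2 => L2 a b) 1).comp
    ((Sobolev a b 1).subtypeL.comp (H10 a b).subtypeL)

theorem fn_sub {a b : ℝ} (v w : H10 a b) : fn (v - w) = fn v - fn w := map_sub (fnL a b) v w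

theorem grad_sub {a b : ℝ} (v w : H10 a b) : grad (v - w) = grad v - grad w :=
  map_sub (gradL a b) v w

theorem fn_smul {a b : ℝ} (c : ℝ) (v : H10 a b) : fn (c • v) = c • fn v :=
  map_smul (fnL a b) c v

theorem grad_smul {a b : ℝ} (c : ℝ) (v : H10 a b) : grad (c • v) = c • grad v :=
  map_smul (gradL a b) c v

/-- The pair `(v, s ∇v)`; the pull-back of the inner product of `L² × L²` along this map is
`(v, w) + s² (∇v, ∇w)`. -/
noncomputable def emb (a b s : ℝ) : H10 a b →L[ℝ] WithLp 2 (L2 a b × L2 a b) :=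
  ((WithLp.prodContinuousLinearEquiv 2 ℝ (L2 a b) (L2 a b)).symm :
    (L2 a b × L2 a b) →L[ℝ] WithLp 2 (L2 a b × L2 a b)).comp ((fnL a b).prod (s • gradL a b))

theorem emb_apply {a b s : ℝ} (v : H10 a b) :
    emb a b s v = WithLp.toLp 2 (fn v, s • grad v) := rfl

theorem inner_emb {a b s : ℝ} (v w : H10 a b) :
    inner ℝ (emb a b s v) (emb a b s w)
      = inner ℝ (fn v) (fn w) + s ^ 2 * inner ℝ (grad v) (grad w) := by
  rw [emb_apply, emb_apply, WithLp.prod_inner_apply]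
  simp only [real_inner_smul_left, real_inner_smul_right]
  ring

theorem norm_fn_le_norm_emb {a b s : ℝ} (v : H10 a b) : ‖fn v‖ ≤ ‖emb a b s v‖ := by
  refine le_of_sq_le_sq ?_ (norm_nonneg _)
  rw [← real_inner_self_eq_norm_sq, ← real_inner_self_eq_norm_sq, inner_emb]
  have : 0 ≤ s ^ 2 * inner ℝ (grad v) (grad v) :=
    mul_nonneg (sq_nonneg s) real_inner_self_nonneg
  linarith

theorem norm_grad_le_norm_emb {a b s : ℝ} (v : H10 a b) :
    s * ‖grad v‖ ≤ ‖emb a b s v‖ := by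
  refine le_of_sq_le_sq ?_ (norm_nonneg _)
  rw [mul_pow, ← real_inner_self_eq_norm_sq, ← real_inner_self_eq_norm_sq, inner_emb]
  have : 0 ≤ inner ℝ (fn v) (fn v) := real_inner_self_nonneg
  linarith

/-- By the description of `H¹₀` through primitives, the range is cut out by two closed conditions:
the first component is the Volterra operator applied to the rescaled second one, and the primitive
vanishes at `b`. Closedness supplies the completeness needed for orthogonal projection. -/
theorem isClosed_range_emb {a b s : ℝ} (hab : a < b) (hs : s ≠ 0) :
    IsClosed ((emb a b s).range : Set (WithLp 2 (L2 a b × L2 a b))) := by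
  obtain ⟨J, hJ⟩ := exists_volterra hab
  have : ((emb a b s).range : Set (WithLp 2 (L2 a b × L2 a b)))
      = {x | x.fst = J (s⁻¹ • x.snd)} ∩ {x | prim (s⁻¹ • x.snd) b = 0} := by
    ext x
    constructor
    · rintro ⟨v, rfl⟩
      obtain ⟨h1, h2⟩ := H10.fn_ae_eq_prim_and hab v
      have e : s⁻¹ • (s • grad v) = grad v := inv_smul_smul₀ hs _
      refine ⟨?_, ?_⟩
      · change fn v = J (s⁻¹ • (s • grad v))
        rw [e]
        exact Lp.ext (h1.trans (hJ _).symm)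
      · change prim (s⁻¹ • (s • grad v)) b = 0
        rw [e, h2]
    · rintro ⟨h1, h2⟩
      obtain ⟨v, hv1, hv2⟩ := H10.exists_of_prim hab.le (f := x.fst) (g := s⁻¹ • x.snd)
        (by rw [show x.fst = J (s⁻¹ • x.snd) from h1]; exact hJ _) h2
      refine ⟨v, ?_⟩
      change emb a b s v = x
      rw [emb_apply, hv1, hv2, smul_inv_smul₀ hs]
      rfl
  rw [this]
  have h2 : Continuous fun x : WithLp 2 (L2 a b × L2 a b) => s⁻¹ • x.snd :=
    (s⁻¹ • WithLp.sndL 2 ℝ (L2 a b) (L2 a b)).continuous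
  exact (isClosed_eq (WithLp.fstL 2 ℝ (L2 a b) (L2 a b)).continuous (J.continuous.comp h2)).inter
    (isClosed_eq ((continuous_prim_right hab).comp h2) continuous_const)

/-- Weak solvability of `v - s² v'' = f` with homogeneous Dirichlet conditions. -/
theorem exists_weak_solution {a b s : ℝ} (hab : a < b) (hs : s ≠ 0) (f : L2 a b) :
    ∃ v : H10 a b, ∀ ξ : H10 a b,
      inner ℝ (fn v) (fn ξ) + s ^ 2 * inner ℝ (grad v) (grad ξ) = inner ℝ f (fn ξ) := by
  have : CompleteSpace (emb a b s).range := (isClosed_range_emb hab hs).completeSpace_coe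
  -- Pairing `(f, 0)` with `(ξ, s ∇ξ)` gives `(f, ξ)`, so the projection of `(f, 0)` onto the range
  -- is the Riesz representative of this functional.
  set x : WithLp 2 (L2 a b × L2 a b) := WithLp.toLp 2 (f, 0)
  obtain ⟨v, hv⟩ := ((emb a b s).range).starProjection_apply_mem x
  refine ⟨v, fun ξ => ?_⟩
  have h : inner ℝ (x - (emb a b s).range.starProjection x) (emb a b s ξ) = 0 :=
    Submodule.starProjection_inner_eq_zero x _ ⟨ξ, rfl⟩
  change emb a b s v = _ at hv
  rw [← hv, inner_sub_left, inner_emb, emb_apply, WithLp.prod_inner_apply] at h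
  simp only [x, inner_zero_left] at h
  linarith

theorem norm_weak_solution_le {a b s : ℝ} (hs : 0 < s) {f : L2 a b} {v : H10 a b}
    (hv : ∀ ξ : H10 a b,
      inner ℝ (fn v) (fn ξ) + s ^ 2 * inner ℝ (grad v) (grad ξ) = inner ℝ f (fn ξ)) :
    ‖fn v‖ ≤ ‖f‖ ∧ ‖grad v‖ ≤ ‖f‖ / s := by
  have h := hv v
  rw [← inner_emb, real_inner_self_eq_norm_sq] at h
  have h1 := real_inner_le_norm f (fn v)
  have h2 := norm_fn_le_norm_emb (s := s) v
  have h3 : ‖emb a b s v‖ ≤ ‖f‖ := by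
    by_contra hc
    nlinarith [norm_nonneg f, norm_nonneg (fn v)]
  refine ⟨h2.trans h3, ?_⟩
  rw [le_div_iff₀' hs]
  exact (norm_grad_le_norm_emb v).trans h3

/-- Elliptic regularity: smooth compactly supported functions are admissible in the weak equation,
which then reads `v'' = s⁻² (v - f)`. -/
theorem isWeakDeriv_grad_of_weak_solution {a b s : ℝ} (hab : a < b) (hs : s ≠ 0) {f : L2 a b}
    {v : H10 a b} (hv : ∀ ξ : H10 a b,
      inner ℝ (fn v) (fn ξ) + s ^ 2 * inner ℝ (grad v) (grad ξ) = inner ℝ f (fn ξ)) :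
    IsWeakDeriv (grad v) ((s ^ 2)⁻¹ • (fn v - f)) := by
  intro φ hφ hφc hφs
  obtain ⟨ξ, h1, h2⟩ := H10.exists_of_test hab.le hφ hφc hφs
  have e : ∀ {g k : L2 a b} {ψ : ℝ → ℝ}, k =ᵐ[volume.restrict (Ioo a b)] ψ →
      ∫ x in Ioo a b, g x * ψ x = inner ℝ g k := by
    intro g k ψ h
    rw [← integral_mul_eq_inner]
    refine integral_congr_ae ?_
    filter_upwards [h] with x hx
    rw [hx]
  rw [e h1, e h2, real_inner_smul_left, inner_sub_left, ← hv ξ]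
  field_simp
  ring

/-! ### The dual problem and the Ritz projection. -/

theorem norm_le_sum_norm {ι E : Type*} [Fintype ι] [NormedAddCommGroup E]
    (x : PiLp 2 fun _ : ι => E) : ‖x‖ ≤ ∑ i, ‖x i‖ := by
  refine le_of_sq_le_sq ?_ (Finset.sum_nonneg fun _ _ => norm_nonneg _)
  rw [PiLp.norm_sq_eq_of_L2]
  exact Finset.sum_sq_le_sq_sum_of_nonneg fun _ _ => norm_nonneg _

theorem H10.norm_le {a b : ℝ} (v : H10 a b) : ‖v‖ ≤ ‖fn v‖ + ‖grad v‖ :=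
  (norm_le_sum_norm (v : Sobolev a b 1).1).trans_eq (Fin.sum_univ_two _)

theorem norm_emb_le {a b s : ℝ} (v : H10 a b) : ‖emb a b s v‖ ≤ (1 + |s|) * ‖v‖ := by
  have h1 : ‖fn v‖ ≤ ‖v‖ := PiLp.norm_apply_le (v : Sobolev a b 1).1 0
  have h2 : ‖grad v‖ ≤ ‖v‖ := PiLp.norm_apply_le (v : Sobolev a b 1).1 1
  have h0 := norm_nonneg (fn v)
  have h0' := norm_nonneg (grad v)
  refine le_of_sq_le_sq ?_ (by positivity)
  rw [← real_inner_self_eq_norm_sq, inner_emb, real_inner_self_eq_norm_sq,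
    real_inner_self_eq_norm_sq, ← sq_abs s]
  have h3 : ‖fn v‖ ^ 2 ≤ ‖v‖ ^ 2 := by gcongr
  have h4 : |s| ^ 2 * ‖grad v‖ ^ 2 ≤ |s| ^ 2 * ‖v‖ ^ 2 := by gcongr
  have h5 : 0 ≤ |s| * ‖v‖ ^ 2 := by positivity
  nlinarith

/-- The solution `φ` of the dual problem with datum `e` can be split as `χ + (φ - χ)`, where
`χ` is of order `h` in `H¹` and `φ - χ` is of order `h⁻²` in `H⁴`. -/
theorem exists_dual_solution {a b μ : ℝ} (hab : a < b) (hμ : 0 < μ) :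
    ∃ C : ℝ, 0 ≤ C ∧ ∀ e : L2 a b, ∃ φ : H10 a b,
      (∀ ξ : H10 a b, inner ℝ (fn φ) (fn ξ) + μ * inner ℝ (grad φ) (grad ξ)
        = inner ℝ e (fn ξ)) ∧
      ∀ h ∈ Ioo (0 : ℝ) 1, ∃ χ : H10 a b, ∃ w : Sobolev a b 4,
        ‖χ‖ ≤ C * h * ‖e‖ ∧ IsH4 (φ - χ) w ∧ ‖w‖ ≤ C / h ^ 2 * ‖e‖ := by
  have hs : 0 < √μ := Real.sqrt_pos.2 hμ
  have hs2 : √μ ^ 2 = μ := Real.sq_sqrt hμ.le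
  -- The `H⁴` norm below is at most `h⁻²` times `‖e‖ + ‖e‖/√μ + 6 ‖ψ‖`, and `‖ψ‖ ≤ 2 μ⁻¹ ‖e‖`.
  refine ⟨1 + (√μ)⁻¹ + 12 * μ⁻¹, by positivity, fun e => ?_⟩
  obtain ⟨φ, hφ⟩ := exists_weak_solution hab hs.ne' e
  obtain ⟨n1, n2⟩ := norm_weak_solution_le hs hφ
  have wφ := isWeakDeriv_grad_of_weak_solution hab hs.ne' hφ
  rw [hs2] at wφ
  refine ⟨φ, by simpa only [hs2] using hφ, fun h hh => ?_⟩
  have h0 := hh.1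
  have h1 := hh.2
  -- `ψ = -φ''`. Let `χ` solve `χ - h² χ'' = ψ`, a smoothing of `ψ` at scale `h` with zero boundary
  -- values. Then `(φ - h² χ)'' = -χ`, which has two further derivatives, and `‖χ'‖ ≤ ‖ψ‖/h` makes
  -- `h² χ` of order `h` in `H¹`.
  set ψ : L2 a b := μ⁻¹ • (e - fn φ) with hψ
  have nψ : ‖ψ‖ ≤ 2 * μ⁻¹ * ‖e‖ := by
    rw [hψ, norm_smul, Real.norm_of_nonneg (by positivity)]
    have := norm_sub_le e (fn φ)
    have hi : 0 < μ⁻¹ := by positivity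
    nlinarith
  obtain ⟨χ, hχ⟩ := exists_weak_solution hab h0.ne' ψ
  obtain ⟨m1, m2⟩ := norm_weak_solution_le h0 hχ
  have wχ := isWeakDeriv_grad_of_weak_solution hab h0.ne' hχ
  set E := ‖e‖
  set m := ‖ψ‖
  have hE : 0 ≤ E := norm_nonneg _
  have hm : 0 ≤ m := norm_nonneg _
  have hmh : m ≤ m / h := by rw [le_div_iff₀ h0]; nlinarith
  have d0 : ∀ v : H10 a b, IsWeakDeriv (fn v) (grad v) := fun v => (v : Sobolev a b 1).2 0
  have hc : IsWeakDeriv (grad (φ - h ^ 2 • χ)) ((-1 : ℝ) • fn χ) := by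
    have := wφ.add (wχ.smul (-h ^ 2))
    convert! this using 1
    · rw [grad_sub, grad_smul]
      module
    · rw [hψ, smul_smul]
      have : -h ^ 2 * (h ^ 2)⁻¹ = -1 := by field_simp
      rw [this]
      module
  let w : Sobolev a b 4 := ⟨WithLp.toLp 2 ![fn (φ - h ^ 2 • χ), grad (φ - h ^ 2 • χ),
    (-1 : ℝ) • fn χ, (-1 : ℝ) • grad χ, (-1 : ℝ) • ((h ^ 2)⁻¹ • (fn χ - ψ))], by
      intro i
      fin_cases i
      · exact d0 (φ - h ^ 2 • χ)
      · exact hc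
      · exact (d0 χ).smul _
      · exact wχ.smul _⟩
  refine ⟨h ^ 2 • χ, w, ?_, rfl, ?_⟩
  · have h2 := H10.norm_le (h ^ 2 • χ)
    rw [fn_smul, grad_smul, norm_smul _ (fn χ), norm_smul _ (grad χ), Real.norm_of_nonneg (by positivity)] at h2
    calc ‖h ^ 2 • χ‖ ≤ h ^ 2 * (m / h) + h ^ 2 * (m / h) := by
          refine h2.trans ?_
          gcongr
          exact m1.trans hmh
      _ = h ^ 2 * (2 * m / h) := by ring
      _ = 2 * m * h := by field_simp
      _ ≤ 4 * μ⁻¹ * E * h := by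
        have : 2 * m ≤ 4 * μ⁻¹ * E := by linarith
        gcongr
      _ ≤ _ := by
        have : 0 ≤ (1 + (√μ)⁻¹ + 8 * μ⁻¹) * (h * E) := by positivity
        linarith
  · have hw : ‖w‖ ≤ ‖fn (φ - h ^ 2 • χ)‖ + ‖grad (φ - h ^ 2 • χ)‖ + ‖(-1 : ℝ) • fn χ‖
        + ‖(-1 : ℝ) • grad χ‖ + ‖(-1 : ℝ) • ((h ^ 2)⁻¹ • (fn χ - ψ))‖ :=
      (norm_le_sum_norm w.1).trans_eq (Fin.sum_univ_five _)
    have hh2 : h ^ 2 ≤ 1 := by nlinarith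
    have k1 : ‖fn (φ - h ^ 2 • χ)‖ ≤ E + m := by
      rw [fn_sub, fn_smul]
      refine (norm_sub_le _ _).trans ?_
      rw [norm_smul, Real.norm_of_nonneg (by positivity)]
      nlinarith [norm_nonneg (fn χ)]
    have k2 : ‖grad (φ - h ^ 2 • χ)‖ ≤ E / √μ + m := by
      rw [grad_sub, grad_smul]
      refine (norm_sub_le _ _).trans ?_
      rw [norm_smul, Real.norm_of_nonneg (by positivity)]
      have : h ^ 2 * ‖grad χ‖ ≤ m := by
        calc h ^ 2 * ‖grad χ‖ ≤ h ^ 2 * (m / h) := by gcongr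
          _ = h * m := by field_simp
          _ ≤ m := by nlinarith
      linarith
    have k5 : ‖(h ^ 2)⁻¹ • (fn χ - ψ)‖ ≤ (h ^ 2)⁻¹ * (2 * m) := by
      rw [norm_smul, Real.norm_of_nonneg (by positivity)]
      have := norm_sub_le (fn χ) ψ
      gcongr
      linarith
    rw [norm_smul (-1 : ℝ), norm_smul (-1 : ℝ), norm_smul (-1 : ℝ), norm_neg, norm_one,
      one_mul, one_mul, one_mul] at hw
    have hi : 1 ≤ (h ^ 2)⁻¹ := (one_le_inv₀ (by positivity)).2 hh2
    have hmh2 : m / h ≤ m * (h ^ 2)⁻¹ := by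
      rw [div_eq_mul_inv]
      gcongr
      nlinarith
    calc ‖w‖ ≤ E + E / √μ + 3 * m + m / h + (h ^ 2)⁻¹ * (2 * m) := by linarith
      _ ≤ (E + E / √μ + 6 * m) * (h ^ 2)⁻¹ := by
        have hq : 0 ≤ E + E / √μ + 3 * m := by positivity
        nlinarith
      _ ≤ (E + E / √μ + 12 * μ⁻¹ * E) * (h ^ 2)⁻¹ := by
        have : 6 * m ≤ 12 * μ⁻¹ * E := by linarith
        gcongr
      _ = _ := by ring

/-- The Aubin–Nitsche estimate for the elliptic (Ritz) projection. -/
theorem exists_ritz_error_bound {a b μ : ℝ} (hab : a < b) (hμ : 0 < μ) (K : ℝ) :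
    ∃ C : ℝ, 0 ≤ C ∧ ∀ (V : Submodule ℝ (H10 a b)), ∀ h ∈ Ioo (0 : ℝ) 1,
      (∀ (v : H10 a b) (w : Sobolev a b 4), IsH4 v w →
        (⨅ ξ : V, ‖v - (ξ : H10 a b)‖) ≤ K * h ^ 3 * ‖w‖) →
      ∀ (v : H10 a b) (w : Sobolev a b 4), IsH4 v w → ∀ r ∈ V,
        (∀ ξ ∈ V, inner ℝ (emb a b √μ (v - r)) (emb a b √μ ξ) = 0) →
        ‖fn (v - r)‖ ≤ C * h ^ 4 * ‖w‖ := by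
  obtain ⟨C, hC, hdual⟩ := exists_dual_solution hab hμ
  set c := 1 + |√μ|
  have hc : 0 ≤ c := by positivity
  refine ⟨c * C * (1 + |K|) * (c * |K|), by positivity, fun V h hh happ v w hvw r hr horth => ?_⟩
  have h0 := hh.1
  set e := fn (v - r)
  set y := emb a b √μ (v - r) with hy
  have bdd : ∀ z : H10 a b, BddBelow (range fun ξ : V => ‖z - (ξ : H10 a b)‖) := fun z =>
    ⟨0, by rintro _ ⟨ξ, rfl⟩; exact norm_nonneg _⟩
  -- Galerkin orthogonality: any element of `V` may be subtracted from `z`. With `z = v` this is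
  -- Céa's lemma; with `z = φ` it is the duality argument.
  have step : ∀ z ξ : H10 a b, ξ ∈ V → inner ℝ (emb a b √μ z) y ≤ c * ‖z - ξ‖ * ‖y‖ := by
    intro z ξ hξ
    have : inner ℝ (emb a b √μ z) y = inner ℝ (emb a b √μ (z - ξ)) y := by
      rw [map_sub, inner_sub_left, real_inner_comm _ (emb a b √μ ξ), horth ξ hξ, sub_zero]
    rw [this]
    refine (real_inner_le_norm _ _).trans ?_
    gcongr
    exact norm_emb_le _
  have hyn : ‖y‖ ≤ c * (|K| * h ^ 3 * ‖w‖) := by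
    have h1 : ‖y‖ ≤ c * ⨅ ξ : V, ‖v - (ξ : H10 a b)‖ := by
      rw [Real.mul_iInf_of_nonneg hc]
      refine le_ciInf fun ξ => ?_
      have h2 : inner ℝ (emb a b √μ v) y = ‖y‖ ^ 2 := by
        rw [← real_inner_self_eq_norm_sq]
        nth_rw 2 [hy]
        rw [map_sub, inner_sub_left, real_inner_comm _ (emb a b √μ r), horth r hr, sub_zero]
      have h3 := step v ξ ξ.2
      rw [h2] at h3
      by_contra hcon
      push Not at hcon
      have : 0 < ‖y‖ := lt_of_le_of_lt (by positivity) hcon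
      nlinarith
    refine h1.trans ?_
    gcongr
    refine (happ v w hvw).trans ?_
    gcongr
    exact le_abs_self K
  obtain ⟨φ, hφ, hsplit⟩ := hdual e
  obtain ⟨χ, z, hχ, hz, hzn⟩ := hsplit h hh
  have he : ‖e‖ ^ 2 = inner ℝ (emb a b √μ φ) y := by
    rw [inner_emb, Real.sq_sqrt hμ.le, hφ, real_inner_self_eq_norm_sq]
  have h4 : ‖e‖ ^ 2 ≤ c * ‖y‖ * (‖χ‖ + ⨅ ξ : V, ‖φ - χ - (ξ : H10 a b)‖) := by
    have : ‖e‖ ^ 2 - c * ‖y‖ * ‖χ‖ ≤ c * ‖y‖ * ⨅ ξ : V, ‖φ - χ - (ξ : H10 a b)‖ := by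
      rw [Real.mul_iInf_of_nonneg (by positivity)]
      refine le_ciInf fun ξ => ?_
      have h5 := step φ ξ ξ.2
      have h6 : ‖φ - (ξ : H10 a b)‖ ≤ ‖χ‖ + ‖φ - χ - (ξ : H10 a b)‖ := by
        rw [sub_right_comm]
        exact norm_le_norm_add_norm_sub' (φ - (ξ : H10 a b)) χ
      have h7 : c * ‖y‖ * ‖φ - (ξ : H10 a b)‖
          ≤ c * ‖y‖ * (‖χ‖ + ‖φ - χ - (ξ : H10 a b)‖) := by gcongr
      rw [he]
      linarith
    linarith
  -- The factor `h³` of the approximation property absorbs the growth `h⁻²` of the `H⁴` norm.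
  have h5 : ⨅ ξ : V, ‖φ - χ - (ξ : H10 a b)‖ ≤ |K| * C * h * ‖e‖ := by
    refine (happ _ z hz).trans ?_
    calc K * h ^ 3 * ‖z‖ ≤ |K| * h ^ 3 * (C / h ^ 2 * ‖e‖) := by
          gcongr
          exact le_abs_self K
      _ = _ := by field_simp
  have h6 : ‖e‖ ^ 2 ≤ c * ‖y‖ * (C * h * ‖e‖ + |K| * C * h * ‖e‖) := by
    refine h4.trans ?_
    gcongr
  have h7 : ‖e‖ ≤ c * C * (1 + |K|) * h * ‖y‖ := by
    by_contra hcon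
    push Not at hcon
    have : 0 < ‖e‖ := lt_of_le_of_lt (by positivity) hcon
    nlinarith
  calc ‖e‖ ≤ c * C * (1 + |K|) * h * ‖y‖ := h7
    _ ≤ c * C * (1 + |K|) * h * (c * (|K| * h ^ 3 * ‖w‖)) := by gcongr
    _ = _ := by ring

/-- The Ritz projection onto a finite dimensional subspace: existence. -/
theorem exists_ritz {a b s : ℝ} (V : Submodule ℝ (H10 a b)) [FiniteDimensional ℝ V] :
    ∃ P : WithLp 2 (L2 a b × L2 a b) →L[ℝ] WithLp 2 (L2 a b × L2 a b),
      (∀ x, ∃ r ∈ V, emb a b s r = P x) ∧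
      (∀ x, ∀ ξ ∈ V, inner ℝ (P x) (emb a b s ξ) = inner ℝ x (emb a b s ξ)) ∧
      ∀ ξ ∈ V, P (emb a b s ξ) = emb a b s ξ := by
  set W := V.map (emb a b s : H10 a b →ₗ[ℝ] WithLp 2 (L2 a b × L2 a b))
  refine ⟨W.starProjection, fun x => W.starProjection_apply_mem x, fun x ξ hξ => ?_,
    fun ξ hξ => Submodule.starProjection_eq_self_iff.2 ⟨ξ, hξ, rfl⟩⟩
  have := W.starProjection_inner_eq_zero x (emb a b s ξ) ⟨ξ, hξ, rfl⟩
  rw [inner_sub_left] at this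
  linarith

/-! ### The nonlinearity on bounded functions. -/

theorem flux_sub_le (p : ℕ) {R : ℝ} {s r : ℝ} (hs : |s| ≤ R) (hr : |r| ≤ R) :
    |flux p s - flux p r| ≤ (1 + p * ((p + 1) * R ^ p)) * |s - r| := by
  have h1 : flux p s - flux p r = -((s - r) + p * (s ^ (p + 1) - r ^ (p + 1))) := by
    unfold flux
    ring
  have h2 : |s ^ (p + 1) - r ^ (p + 1)| ≤ |s - r| * (p + 1) * R ^ p := by
    refine (abs_pow_sub_pow_le s r (p + 1)).trans ?_
    push_cast [Nat.add_sub_cancel]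
    gcongr
    exact max_le hs hr
  rw [h1, abs_neg]
  refine (abs_add_le _ _).trans ?_
  rw [abs_mul, Nat.abs_cast]
  have : (p : ℝ) * |s ^ (p + 1) - r ^ (p + 1)| ≤ p * (|s - r| * (p + 1) * R ^ p) := by gcongr
  linarith

theorem continuous_flux (p : ℕ) : Continuous (flux p) := by
  unfold flux
  fun_prop

theorem flux_zero (p : ℕ) : flux p 0 = 0 := by simp [flux]

theorem memLp_flux {a b : ℝ} (p : ℕ) {R : ℝ} {f : L2 a b}
    (hf : ∀ᵐ x ∂volume.restrict (Ioo a b), |f x| ≤ R) :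
    MemLp (fun x => flux p (f x)) 2 (volume.restrict (Ioo a b)) := by
  refine MemLp.of_bound ((continuous_flux p).comp_aestronglyMeasurable
    (Lp.aestronglyMeasurable f)) ((1 + p * ((p + 1) * R ^ p)) * R) ?_
  filter_upwards [hf] with x hx
  have hR : 0 ≤ R := (abs_nonneg _).trans hx
  have := flux_sub_le p hx (r := 0) (by simpa using hR)
  rw [flux_zero, sub_zero, sub_zero] at this
  refine this.trans ?_
  gcongr

theorem abs_integral_flux_sub_le {a b : ℝ} (p : ℕ) {R : ℝ} {f k g : L2 a b}
    (hf : ∀ᵐ x ∂volume.restrict (Ioo a b), |f x| ≤ R)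
    (hk : ∀ᵐ x ∂volume.restrict (Ioo a b), |k x| ≤ R) :
    |(∫ x in Ioo a b, flux p (f x) * g x) - ∫ x in Ioo a b, flux p (k x) * g x|
      ≤ (1 + p * ((p + 1) * R ^ p)) * ‖f - k‖ * ‖g‖ := by
  have mf := memLp_flux p hf
  have mk := memLp_flux p hk
  have e : ∀ {l : L2 a b} (m : MemLp (fun x => flux p (l x)) 2 (volume.restrict (Ioo a b))),
      ∫ x in Ioo a b, flux p (l x) * g x = inner ℝ m.toLp g := by
    intro l m
    rw [← integral_mul_eq_inner]
    refine integral_congr_ae ?_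
    filter_upwards [m.coeFn_toLp] with x hx
    rw [hx]
  rw [e mf, e mk, ← inner_sub_left]
  refine (abs_real_inner_le_norm _ _).trans ?_
  gcongr
  refine Lp.norm_le_mul_norm_of_ae_le_mul ?_
  filter_upwards [hf, hk, mf.coeFn_toLp, mk.coeFn_toLp, Lp.coeFn_sub mf.toLp mk.toLp,
    Lp.coeFn_sub f k] with x h1 h2 h3 h4 h5 h6
  rw [h5, h6, Pi.sub_apply, Pi.sub_apply, h3, h4]
  exact flux_sub_le p h1 h2

/-- Both monomials of `F(v)` times `∇v` are exact derivatives of powers of `v`, which vanish at the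
end points. This is what makes the energy a conserved quantity. -/
theorem integral_flux_mul_grad_self {a b : ℝ} (hab : a < b) (p : ℕ) (v : H10 a b) :
    ∫ x in Ioo a b, flux p (fn v x) * grad v x = 0 := by
  have hb := H10.ae_abs_fn_le hab v
  have hi : ∀ n : ℕ, IntegrableOn (fun x => fn v x ^ n * grad v x) (Ioo a b) := by
    intro n
    refine Integrable.bdd_mul (c := (√(b - a) * ‖grad v‖) ^ n)
      ((Lp.memLp (grad v)).integrable (by norm_num))
      ((Lp.aestronglyMeasurable (fn v)).pow n) ?_
    filter_upwards [hb] with x hx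
    rw [norm_pow]
    exact pow_le_pow_left₀ (norm_nonneg _) hx n
  have e : ∀ x, flux p (fn v x) * grad v x
      = -1 * (fn v x ^ 1 * grad v x) + -p * (fn v x ^ (p + 1) * grad v x) := by
    intro x
    unfold flux
    ring
  simp_rw [e]
  rw [integral_add ((hi 1).const_mul _) ((hi (p + 1)).const_mul _), integral_const_mul,
    integral_const_mul, H10.integral_fn_pow_mul_grad hab, H10.integral_fn_pow_mul_grad hab]
  simp

/-! ### Energy conservation and the error equation in time. -/

theorem hasDerivWithinAt_Ici_of_Icc {E : Type*} [NormedAddCommGroup E] [NormedSpace ℝ E]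
    {f : ℝ → E} {f' : E} {T t : ℝ} (h : HasDerivWithinAt f f' (Icc 0 T) t) (ht : t ∈ Ico 0 T) :
    HasDerivWithinAt f f' (Ici t) t :=
  h.mono_of_mem_nhdsWithin (Icc_mem_nhdsGE_of_mem ht)

set_option maxSynthPendingDepth 3 in
theorem hasDerivWithinAt_emb {a b s : ℝ} {u : ℝ → H10 a b} {w : H10 a b} {I : Set ℝ} {t : ℝ}
    (h : HasDerivWithinAt u w I t) :
    HasDerivWithinAt (fun t => emb a b s (u t)) (emb a b s w) I t :=
  (emb a b s).hasFDerivAt.comp_hasDerivWithinAt t h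

/-- Conservation of the energy `‖v‖² + μ ‖∇v‖²`. -/
theorem IsSolution.norm_emb_eq {a b μ T : ℝ} (hab : a < b) (hμ : 0 < μ) {p : ℕ}
    {V : Submodule ℝ (H10 a b)} {u₀ : H10 a b} {u : ℝ → H10 a b}
    (hu : IsSolution μ p T V u₀ u) {t : ℝ} (ht : t ∈ Icc 0 T) :
    ‖emb a b √μ (u t)‖ = ‖emb a b √μ u₀‖ := by
  choose! w hw using hu.equation
  have hd : ∀ t ∈ Icc 0 T, HasDerivWithinAt (fun t => ‖emb a b √μ (u t)‖ ^ 2) 0 (Icc 0 T) t := by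
    intro t ht
    have h1 := (hasDerivWithinAt_emb (s := √μ) (hw t ht).1).norm_sq
    -- The solution itself is an admissible test function, since `u t ∈ V`.
    have h2 : inner ℝ (emb a b √μ (u t)) (emb a b √μ (w t)) = 0 := by
      rw [real_inner_comm, inner_emb, Real.sq_sqrt hμ.le, (hw t ht).2 _ (hu.mem t ht),
        integral_flux_mul_grad_self hab, neg_zero]
    simpa [h2] using h1
  have h := constant_of_has_deriv_right_zero (fun t ht => (hd t ht).continuousWithinAt)
    (fun t ht => hasDerivWithinAt_Ici_of_Icc (hd t (Ico_subset_Icc_self ht)) ht) t ht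
  rw [← hu.initial]
  exact (sq_eq_sq₀ (norm_nonneg _) (norm_nonneg _)).1 h

theorem IsSolution.ae_abs_le {a b μ T : ℝ} (hab : a < b) (hμ : 0 < μ) {p : ℕ}
    {V : Submodule ℝ (H10 a b)} {u₀ : H10 a b} {u : ℝ → H10 a b}
    (hu : IsSolution μ p T V u₀ u) {t : ℝ} (ht : t ∈ Icc 0 T) :
    ∀ᵐ x ∂volume.restrict (Ioo a b),
      |fn (u t) x| ≤ √(b - a) * ((1 + |√μ|) * ‖u₀‖ / √μ) := by
  have h1 : ‖grad (u t)‖ ≤ (1 + |√μ|) * ‖u₀‖ / √μ := by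
    rw [le_div_iff₀' (Real.sqrt_pos.2 hμ)]
    refine (norm_grad_le_norm_emb _).trans ?_
    rw [hu.norm_emb_eq hab hμ ht]
    exact norm_emb_le _
  filter_upwards [H10.ae_abs_fn_le hab (u t)] with x hx
  refine hx.trans ?_
  gcongr

/-- The `L²` error of the Galerkin solution is controlled by that of the Ritz projection and of
the initial datum. -/
theorem norm_fn_sub_le_of_ritz {a b μ T : ℝ} (hμ : 0 < μ) (hT : 0 < T) {p : ℕ}
    {V : Submodule ℝ (H10 a b)} [FiniteDimensional ℝ V] {u₀ v₀ : H10 a b} {u v : ℝ → H10 a b}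
    (hu : IsSolution μ p T ⊤ u₀ u) (hv : IsSolution μ p T V v₀ v) {R : ℝ} (hR : 0 ≤ R)
    (huR : ∀ t ∈ Icc 0 T, ∀ᵐ x ∂volume.restrict (Ioo a b), |fn (u t) x| ≤ R)
    (hvR : ∀ t ∈ Icc 0 T, ∀ᵐ x ∂volume.restrict (Ioo a b), |fn (v t) x| ≤ R)
    {D : ℝ} (hD : 0 ≤ D) (hritz : ∀ t ∈ Icc 0 T, ∀ r ∈ V,
      (∀ ξ ∈ V, inner ℝ (emb a b √μ (u t - r)) (emb a b √μ ξ) = 0) → ‖fn (u t - r)‖ ≤ D)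
    (hinit : ‖fn (u 0 - v 0)‖ ≤ D) {t : ℝ} (ht : t ∈ Icc 0 T) :
    ‖fn (u t - v t)‖
      ≤ (1 + 3 * Real.exp ((1 + p * ((p + 1) * R ^ p)) / √μ * T)) * D := by
  have hs : 0 < √μ := Real.sqrt_pos.2 hμ
  set L := 1 + p * ((p + 1) * R ^ p) with hL
  have hLpos : 0 < L := by positivity
  set c := L / √μ
  have hc : 0 < c := by positivity
  obtain ⟨P, hPV, hP, hPid⟩ := exists_ritz (s := √μ) V
  choose! w hw using hu.equation
  choose! z hz using hv.equation
  set θ : ℝ → WithLp 2 (L2 a b × L2 a b) := fun t => P (emb a b √μ (u t)) - emb a b √μ (v t)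
  set θ' : ℝ → WithLp 2 (L2 a b × L2 a b) := fun t => P (emb a b √μ (w t)) - emb a b √μ (z t)
  have hθ : ∀ t ∈ Icc 0 T, HasDerivWithinAt θ (θ' t) (Icc 0 T) t := fun t ht =>
    (P.hasFDerivAt.comp_hasDerivWithinAt t
      (hasDerivWithinAt_emb (s := √μ) (hw t ht).1)).sub
      (hasDerivWithinAt_emb (s := √μ) (hz t ht).1)
  have hsplit : ∀ t ∈ Icc 0 T, ‖fn (u t - v t) - (θ t).fst‖ ≤ D := by
    intro t ht
    obtain ⟨r, hr, hrP⟩ := hPV (emb a b √μ (u t))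
    have h1 := hritz t ht r hr fun ξ hξ => by
      rw [map_sub, inner_sub_left, hrP, hP _ ξ hξ, sub_self]
    have h2 : fn (u t - v t) - (θ t).fst = fn (u t - r) := by
      have : (θ t).fst = fn r - fn (v t) := by
        simp only [θ]
        rw [← hrP]
        rfl
      rw [this, fn_sub, fn_sub]
      abel
    rwa [h2]
  -- To be used as a test function, `θ'` must come from `V`. The derivative of `u_h` is only known
  -- to lie in `H¹₀`; but `P` fixes the embedded curve `u_h`, so by uniqueness of derivatives on
  -- `[0, T]` it fixes the embedded derivative too.
  have hzV : ∀ t ∈ Icc 0 T, ∃ ξ ∈ V, emb a b √μ ξ = θ' t := by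
    intro t ht
    have h1 : P (emb a b √μ (z t)) = emb a b √μ (z t) := by
      have hd := hasDerivWithinAt_emb (s := √μ) (hz t ht).1
      refine (uniqueDiffOn_Icc hT t ht).eq_deriv _
        ((P.hasFDerivAt.comp_hasDerivWithinAt t hd).congr (fun s hs => ?_) ?_) hd
      · exact (hPid _ (hv.mem s hs)).symm
      · exact (hPid _ (hv.mem t ht)).symm
    obtain ⟨ξ, hξ, hξP⟩ := hPV (emb a b √μ (w t) - emb a b √μ (z t))
    refine ⟨ξ, hξ, ?_⟩
    rw [hξP, map_sub, h1]
  -- Test the difference of the two equations with `θ'`. The projection `P` drops out against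
  -- elements of `V`, and only the flux difference remains.
  have hbound : ∀ t ∈ Icc 0 T, ‖θ' t‖ ≤ c * ‖fn (u t - v t)‖ := by
    intro t ht
    obtain ⟨ξ, hξ, hξθ⟩ := hzV t ht
    have h1 : ‖θ' t‖ ^ 2 = (∫ x in Ioo a b, flux p (fn (v t) x) * grad ξ x)
        - ∫ x in Ioo a b, flux p (fn (u t) x) * grad ξ x := by
      rw [← real_inner_self_eq_norm_sq]
      nth_rw 2 [← hξθ]
      rw [inner_sub_left, hP _ ξ hξ, inner_emb, inner_emb, Real.sq_sqrt hμ.le,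
        (hw t ht).2 ξ trivial, (hz t ht).2 ξ hξ]
      ring
    have h2 := abs_integral_flux_sub_le p (g := grad ξ) (hvR t ht) (huR t ht)
    rw [← h1, abs_of_nonneg (sq_nonneg _), norm_sub_rev (fn _), ← fn_sub, ← hL] at h2
    have h3 : ‖grad ξ‖ ≤ ‖θ' t‖ / √μ := by
      rw [le_div_iff₀' hs, ← hξθ]
      exact norm_grad_le_norm_emb ξ
    have h4 : ‖θ' t‖ ^ 2 ≤ c * ‖fn (u t - v t)‖ * ‖θ' t‖ := by
      calc ‖θ' t‖ ^ 2 ≤ L * ‖fn (u t - v t)‖ * ‖grad ξ‖ := h2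
        _ ≤ L * ‖fn (u t - v t)‖ * (‖θ' t‖ / √μ) := by gcongr
        _ = _ := by simp only [c]; ring
    by_contra hcon
    push Not at hcon
    have : 0 < ‖θ' t‖ := lt_of_le_of_lt (by positivity) hcon
    nlinarith
  set F := WithLp.fstL 2 ℝ (L2 a b) (L2 a b)
  have hF : ∀ x : WithLp 2 (L2 a b × L2 a b), ‖F x‖ ≤ ‖x‖ := fun x =>
    WithLp.norm_fst_le _ x
  have hy : ∀ t ∈ Icc 0 T, HasDerivWithinAt (fun t => F (θ t)) (F (θ' t)) (Icc 0 T) t :=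
    fun t ht => F.hasFDerivAt.comp_hasDerivWithinAt t (hθ t ht)
  have htri : ∀ t ∈ Icc 0 T, ‖fn (u t - v t)‖ ≤ D + ‖F (θ t)‖ := fun t ht => by
    have h1 := norm_sub_norm_le (fn (u t - v t)) (F (θ t))
    have h2 : ‖fn (u t - v t) - F (θ t)‖ ≤ D := hsplit t ht
    linarith
  have h0 : (0 : ℝ) ∈ Icc 0 T := ⟨le_rfl, hT.le⟩
  have hstart : ‖F (θ 0)‖ ≤ 2 * D := by
    have h1 := norm_sub_norm_le (F (θ 0)) (fn (u 0 - v 0))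
    have h2 : ‖F (θ 0) - fn (u 0 - v 0)‖ ≤ D := by
      rw [norm_sub_rev]
      exact hsplit 0 h0
    linarith
  -- Gronwall for the `L²` component of `θ`, with initial size `2D` and forcing `c D`, gives `2D
  -- e^{ct} + D (e^{ct} - 1)`.
  have hg := norm_le_gronwallBound_of_norm_deriv_right_le (K := c) (ε := c * D)
    (fun t ht => (hy t ht).continuousWithinAt)
    (fun t ht => hasDerivWithinAt_Ici_of_Icc (hy t (Ico_subset_Icc_self ht)) ht) hstart
    (fun t ht => by
      have ht' := Ico_subset_Icc_self ht
      calc ‖F (θ' t)‖ ≤ c * ‖fn (u t - v t)‖ := (hF _).trans (hbound t ht')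
        _ ≤ c * (D + ‖F (θ t)‖) := by
          gcongr
          exact htri t ht'
        _ = c * ‖F (θ t)‖ + c * D := by ring) t ht
  rw [gronwallBound_of_K_ne_0 hc.ne', sub_zero, mul_div_cancel_left₀ _ hc.ne'] at hg
  have hexp : Real.exp (c * t) ≤ Real.exp (c * T) := by
    gcongr
    exact ht.2
  have := htri t ht
  nlinarith

end GRLW

theorem mainTheorem4 (a b : ℝ) (hab : a < b) (μ : ℝ) (hμ : 0 < μ) (p : ℕ) (hp : 1 ≤ p)
    (T : ℝ) (hT : 0 < T)
    -- the finite element spaces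
    (S : ℝ → Submodule ℝ (GRLW.H10 a b))
    (hfin : ∀ h ∈ Set.Ioo (0 : ℝ) 1, FiniteDimensional ℝ (S h))
    (happrox : GRLW.ApproximationProperty S)
    -- the exact solution, which is bounded on `[0, T]` with values in `H⁴`
    (u₀ : GRLW.H10 a b) (u : ℝ → GRLW.H10 a b)
    (hu : GRLW.IsSolution μ p T ⊤ u₀ u)
    (hreg : ∃ M : ℝ, ∀ t ∈ Set.Icc 0 T, ∃ w : GRLW.Sobolev a b 4, GRLW.IsH4 (u t) w ∧ ‖w‖ ≤ M)
    -- the semi-discrete Galerkin solutions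
    (u₀h : ℝ → GRLW.H10 a b) (uh : ℝ → ℝ → GRLW.H10 a b)
    (huh : ∀ h ∈ Set.Ioo (0 : ℝ) 1, GRLW.IsSolution μ p T (S h) (u₀h h) (uh h))
    -- the discrete initial data: bounded in `H¹`, and accurate of order four in `L²`
    (hbdd : ∃ B : ℝ, ∀ h ∈ Set.Ioo (0 : ℝ) 1, ‖u₀h h‖ ≤ B)
    (hinit : ∃ C₀ : ℝ, ∀ h ∈ Set.Ioo (0 : ℝ) 1, ‖GRLW.fn (u 0 - u₀h h)‖ ≤ C₀ * h ^ 4) :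
    ∃ C : ℝ, 0 < C ∧ ∀ h ∈ Set.Ioo (0 : ℝ) 1, ∀ t ∈ Set.Icc 0 T,
      ‖GRLW.fn (u t - uh h t)‖ ≤ C * h ^ 4 := by
  obtain ⟨K, hK⟩ := happrox
  obtain ⟨M, hM⟩ := hreg
  obtain ⟨B, hB⟩ := hbdd
  obtain ⟨C₀, hC₀⟩ := hinit
  obtain ⟨C₁, hC₁, hritz⟩ := GRLW.exists_ritz_error_bound hab hμ K
  -- A sup bound common to `u` and all `u_h`, hence a Lipschitz constant independent of `h`.
  set R := √(b - a) * ((1 + |√μ|) * max ‖u₀‖ B / √μ)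
  have hmax : 0 ≤ max ‖u₀‖ B := (norm_nonneg _).trans (le_max_left _ _)
  have hR : 0 ≤ R := by positivity
  -- `D h⁴` dominates both the Ritz error and the initial error; the summand `1` makes the final
  -- constant strictly positive.
  set D := max (C₁ * |M|) |C₀| + 1
  have hD : 0 < D := by positivity
  refine ⟨(1 + 3 * Real.exp ((1 + p * ((p + 1) * R ^ p)) / √μ * T)) * D, by positivity,
    fun h hh t ht => ?_⟩
  have h0 := hh.1
  have := hfin h hh
  have hbd : ∀ {V : Submodule ℝ (GRLW.H10 a b)} {v₀ : GRLW.H10 a b} {v : ℝ → GRLW.H10 a b},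
      GRLW.IsSolution μ p T V v₀ v → ‖v₀‖ ≤ max ‖u₀‖ B → ∀ t ∈ Icc 0 T,
      ∀ᵐ x ∂volume.restrict (Ioo a b), |GRLW.fn (v t) x| ≤ R := by
    intro V v₀ v hv hv₀ t ht
    filter_upwards [hv.ae_abs_le hab hμ ht] with x hx
    refine hx.trans ?_
    simp only [R]
    gcongr
  rw [mul_assoc]
  refine GRLW.norm_fn_sub_le_of_ritz hμ hT hu (huh h hh) hR (hbd hu (le_max_left _ _))
    (hbd (huh h hh) ((hB h hh).trans (le_max_right _ _))) (by positivity) ?_ ?_ ht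
  · intro s hs r hr horth
    obtain ⟨w, hw, hwM⟩ := hM s hs
    calc ‖GRLW.fn (u s - r)‖ ≤ C₁ * h ^ 4 * ‖w‖ :=
          hritz (S h) h hh (fun v w hvw => (hK h hh v w hvw).2) (u s) w hw r hr horth
      _ ≤ C₁ * h ^ 4 * |M| := by
          gcongr
          exact hwM.trans (le_abs_self M)
      _ = C₁ * |M| * h ^ 4 := by ring
      _ ≤ D * h ^ 4 := by
          gcongr
          exact (le_max_left _ _).trans (le_add_of_nonneg_right zero_le_one)
  · rw [(huh h hh).initial]
    refine (hC₀ h hh).trans ?_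
    gcongr
    exact (le_abs_self C₀).trans
      ((le_max_right _ _).trans (le_add_of_nonneg_right zero_le_one))
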